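/- Let $p$ be a prime and $S$ a finite $p$-group. A category $\mathcal F$ on $S$ has as objects the subgroups of $S$ and as morphisms $\operatorname{Hom}_{\mathcal F}(P,R)$ a set of injective group homomorphisms $P\to R$ (composed as usual), containing all inclusions, and containing with each $\varphi:P\to R$ the induced isomorphism $P\simeq\varphi(P)$ and its inverse. Write $\operatorname{Aut}_{\mathcal F}(P)=\operatorname{Hom}_{\mathcal F}(P,P)$ and $\operatorname{Aut}_S(P)$ for the group of automorphisms of $P$ induced by conjugation by elements of $N_S(P)$. A subgroup $P\le S$ is fully $\mathcal F$-normalized if $|N_S(P)|\ge|N_S(P')|$ for every $P'\le S$ that is isomorphic to $P$ by a morphism of $\mathcal F$. The category $\mathcal F$ is a fusion system on $S$ if (1) every homomorphism $P\to R$ between subgroups of $S$ given by conjugation by an element of $S$ is in $\mathcal F$; (2) $\operatorname{Aut}_S(S)$ is a Sylow $p$-subgroup of $\operatorname{Aut}_{\mathcal F}(S)$; (3) every $\varphi:P\to S$ in $\mathcal F$ with $\varphi(P)$ fully $\mathcal F$-normalized extends to a morphism $N_\varphi\to S$ of $\mathcal F$, where $$N_\varphi=\{x\in N_S(P)\mid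 \exists\, y\in N_S(\varphi(P)),\ \varphi(xux^{-1})=y\varphi(u)y^{-1}\ \ \forall u\in P\}.$$ For $P\le S$, let $N_{\mathcal F}(P)$ be the category on $N_S(P)$ whose morphisms are the homomorphisms $\varphi:A\to B$, with $A,B\le N_S(P)$, for which there is a morphism $\psi:PA\to PB$ of $\mathcal F$ with $\psi|_A=\varphi$ and $\psi|_P\in\operatorname{Aut}_{\mathcal F}(P)$. Let $N_S(P)C_{\mathcal F}(P)$ be the category on $N_S(P)$ defined in the same way, except that $\psi|_P$ is required to be conjugation by an element of $N_S(P)$; when $P\trianglelefteq S$ it is denoted $S\,C_{\mathcal F}(P)$. The subgroup $P$ is normal in $\mathcal F$ if $\mathcal F=N_{\mathcal F}(P)$, and $O_p(\mathcal F)$ is the largest subgroup of $S$ that is normal in $\mathcal F$. **Lemma.** Let $\mathcal F$ be a fusion system on $S$, let $Q=O_p(\mathcal F)$ and $R=Q\,C_S(Q)$. Then $Q$ and $R$ are normal in $S$, so that $\mathcal F_1=S\,C_{\mathcal F}(Q)$ and $\mathcal F_2=N_{\mathcal F}(R)$ are categories on $S$, and $\mathcal F=\langle\mathcal F_1,\mathcal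 F_2\rangle$, the smallest category on $S$ that contains $\mathcal F_1$ and $\mathcal F_2$. -/

import Mathlib

/-- The image `φ(P)` of a homomorphism `φ : P → Q` between subgroups of `G`, as a subgroup of `G`. -/
def homImage {G : Type*} [Group G] {P Q : Subgroup G} (φ : P →* Q) : Subgroup G :=
  (Q.subtype.comp φ).range

/-- The isomorphism `P ≃ φ(P)` induced by an injective homomorphism `φ : P → Q`. -/
noncomputable def homImageEquiv {G : Type*} [Group G] {P Q : Subgroup G} (φ : P →* Q)
    (h : Function.Injective φ) : P ≃* homImage φ :=
  MonoidHom.ofInjective (f := Q.subtype.comp φ) (Q.subtype_injective.comp h)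

theorem homImageEquiv_apply {G : Type*} [Group G] {P Q : Subgroup G} (φ : P →* Q)
    (h : Function.Injective φ) (x : P) : (homImageEquiv φ h x : G) = φ x := rfl

theorem homImage_le {G : Type*} [Group G] {P Q : Subgroup G} (φ : P →* Q) : homImage φ ≤ Q := by
  rintro _ ⟨x, rfl⟩
  exact (φ x).2

/-- `ψ` restricts to `φ` (equivalently, `ψ` extends `φ`): the domain of `φ` is contained in the
domain of `ψ` and the two maps agree there, as maps into `G`. -/
def Restricts {G : Type*} [Group G] {A B P Q : Subgroup G} (ψ : A →* B) (φ : P →* Q) : Prop :=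
  ∃ h : P ≤ A, ∀ x : P, (ψ (Subgroup.inclusion h x) : G) = φ x

/-- A category on a subgroup `base` of an ambient group `G` (any group `S` is a subgroup of itself):
the objects are the subgroups of `base`, the morphisms are injective group homomorphisms, they
include the inclusions, are closed under composition, and along with each `φ : P → Q` contain
the induced isomorphism `P ≃ φ(P)` and its inverse. `Hom P Q` is empty unless `P, Q ≤ base`. -/
@[ext]
structure CategoryOn (G : Type*) [Group G] where
  base : Subgroup G
  Hom : (P Q : Subgroup G) → Set (P →* Q)
  le_base : ∀ {P Q : Subgroup G} {φ : P →* Q}, φ ∈ Hom P Q → P ≤ base ∧ Q ≤ base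
  injective : ∀ {P Q : Subgroup G} {φ : P →* Q}, φ ∈ Hom P Q → Function.Injective φ
  inclusion_mem : ∀ {P Q : Subgroup G} (h : P ≤ Q), Q ≤ base → Subgroup.inclusion h ∈ Hom P Q
  comp_mem : ∀ {P Q R : Subgroup G} {φ : P →* Q} {ψ : Q →* R},
    φ ∈ Hom P Q → ψ ∈ Hom Q R → ψ.comp φ ∈ Hom P R
  image_mem : ∀ {P Q : Subgroup G} {φ : P →* Q} (h : φ ∈ Hom P Q),
    (homImageEquiv φ (injective h)).toMonoidHom ∈ Hom P (homImage φ)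
  image_symm_mem : ∀ {P Q : Subgroup G} {φ : P →* Q} (h : φ ∈ Hom P Q),
    (homImageEquiv φ (injective h)).symm.toMonoidHom ∈ Hom (homImage φ) P

namespace CategoryOn

variable {G : Type*} [Group G]

/-- `N_S(P)`, where `S` is the base of `F`. -/
def baseNormalizer (F : CategoryOn G) (P : Subgroup G) : Subgroup G :=
  F.base ⊓ Subgroup.normalizer (P : Set G)

/-- `C_S(P)`, where `S` is the base of `F`. -/
def baseCentralizer (F : CategoryOn G) (P : Subgroup G) : Subgroup G :=
  F.base ⊓ Subgroup.centralizer (P : Set G)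

/-- `P` and `P'` are `F`-conjugate: some morphism `P → P'` of `F` is an isomorphism. -/
def IsConj (F : CategoryOn G) (P P' : Subgroup G) : Prop :=
  ∃ e : P ≃* P', e.toMonoidHom ∈ F.Hom P P'

/-- `P` is fully `F`-normalized. -/
def FullyNormalized (F : CategoryOn G) (P : Subgroup G) : Prop :=
  P ≤ F.base ∧ ∀ P' : Subgroup G, F.IsConj P P' →
    Nat.card (F.baseNormalizer P') ≤ Nat.card (F.baseNormalizer P)

/-- The group `Aut_F(P)` of automorphisms of `P` that are morphisms of `F`. -/
def autF (F : CategoryOn G) (P : Subgroup G) (hP : P ≤ F.base) : Subgroup (MulAut P) where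
  carrier := {α | MulEquiv.toMonoidHom α ∈ F.Hom P P}
  one_mem' := F.inclusion_mem le_rfl hP
  mul_mem' := fun {a b} ha hb => by
    have := F.comp_mem (φ := MulEquiv.toMonoidHom b) (ψ := MulEquiv.toMonoidHom a) hb ha
    exact this
  inv_mem' := fun {a} ha => by
    have hle : P ≤ homImage (MulEquiv.toMonoidHom a) := fun x hx =>
      ⟨a.symm ⟨x, hx⟩, by simp⟩
    have h := F.comp_mem (F.inclusion_mem hle ((homImage_le _).trans hP)) (F.image_symm_mem ha)
    change MulEquiv.toMonoidHom a⁻¹ ∈ F.Hom P P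
    convert h using 1
    ext x
    obtain ⟨y, rfl⟩ := a.surjective x
    have : (homImageEquiv (MulEquiv.toMonoidHom a) (F.injective ha)).symm
        (Subgroup.inclusion hle (a y)) = y := by
      rw [MulEquiv.symm_apply_eq]
      exact Subtype.ext rfl
    refine Eq.trans ?_ (congrArg Subtype.val this).symm
    exact congrArg Subtype.val (MulAut.inv_apply_self _ a y)

/-- The group `Aut_S(P)` of automorphisms of `P` induced by conjugation by an element of the
base `S` of `F` (necessarily an element of `N_S(P)`). -/
def autBase (F : CategoryOn G) (P : Subgroup G) : Subgroup (MulAut P) where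
  carrier := {α | ∃ x ∈ F.base, ∀ u : P, (α u : G) = x * u * x⁻¹}
  one_mem' := ⟨1, one_mem _, fun u => by simp⟩
  mul_mem' := by
    rintro a b ⟨x, hx, hxa⟩ ⟨y, hy, hyb⟩
    refine ⟨x * y, mul_mem hx hy, fun u => ?_⟩
    rw [MulAut.mul_apply, hxa, hyb]
    group
  inv_mem' := by
    rintro a ⟨x, hx, hxa⟩
    refine ⟨x⁻¹, inv_mem hx, fun u => ?_⟩
    obtain ⟨v, rfl⟩ := a.surjective u
    rw [MulAut.inv_apply_self, hxa]
    group

/-- `N_φ = {x ∈ N_S(P) | ∃ y ∈ N_S(φ(P)), φ(x u x⁻¹) = y φ(u) y⁻¹ for all u ∈ P}`. -/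
def extensionDomain (F : CategoryOn G) {P Q : Subgroup G} (φ : P →* Q) : Subgroup G where
  carrier := {x | x ∈ F.baseNormalizer P ∧ ∃ y ∈ F.baseNormalizer (homImage φ),
    ∀ u v : P, (v : G) = x * u * x⁻¹ → (φ v : G) = y * φ u * y⁻¹}
  one_mem' := ⟨one_mem _, 1, one_mem _, fun u v h => by
    have : v = u := Subtype.ext (by simpa using h)
    simp [this]⟩
  mul_mem' := by
    rintro a b ⟨ha, y, hy, h⟩ ⟨hb, z, hz, k⟩
    refine ⟨mul_mem ha hb, y * z, mul_mem hy hz, fun u v huv => ?_⟩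
    have hw : b * u * b⁻¹ ∈ P := (Subgroup.mem_normalizer_iff.1 hb.2 u).1 u.2
    rw [h ⟨_, hw⟩ v (by rw [huv]; group), k u ⟨_, hw⟩ rfl]
    group
  inv_mem' := by
    rintro a ⟨ha, y, hy, h⟩
    refine ⟨inv_mem ha, y⁻¹, inv_mem hy, fun u v huv => ?_⟩
    rw [h v u (by rw [huv]; group)]
    group

/-- `A` is a Sylow `p`-subgroup of `B`, both being subgroups of `H`. -/
def IsSylowIn {H : Type*} [Group H] (p : ℕ) (A B : Subgroup H) : Prop :=
  A ≤ B ∧ ∃ T : Sylow p B, (T : Subgroup B) = A.subgroupOf B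

/-- `F` is a (saturated) fusion system on the finite `p`-group `S`. -/
structure IsFusionSystem (F : CategoryOn G) (p : ℕ) (S : Subgroup G) : Prop where
  base_eq : F.base = S
  finite : Finite S
  isPGroup : IsPGroup p S
  /-- Conjugations by elements of `S` are morphisms of `F`. -/
  conj_mem : ∀ u ∈ S, ∀ P Q : Subgroup G, P ≤ S → Q ≤ S → ∀ φ : P →* Q,
    (∀ x : P, (φ x : G) = u * x * u⁻¹) → φ ∈ F.Hom P Q
  /-- `Aut_S(S)` is a Sylow `p`-subgroup of `Aut_F(S)`. -/
  sylow : IsSylowIn p (F.autBase S) (F.autF S base_eq.ge)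
  /-- Each `φ : P → S` in `F` with `φ(P)` fully `F`-normalized extends to `N_φ → S` in `F`. -/
  extension : ∀ (P : Subgroup G) (φ : P →* S), φ ∈ F.Hom P S →
    F.FullyNormalized (homImage φ) →
    ∃ ψ ∈ F.Hom (F.extensionDomain φ) S, Restricts ψ φ

theorem inj_of_restricts (F : CategoryOn G) {A B P Q : Subgroup G} {ψ : A →* B} {φ : P →* Q}
    (h : Restricts ψ φ) (hψ : ψ ∈ F.Hom A B) : Function.Injective φ := by
  obtain ⟨h, hx⟩ := h
  intro x y hxy
  have : ψ (Subgroup.inclusion h x) = ψ (Subgroup.inclusion h y) :=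
    Subtype.ext (by rw [hx, hx, hxy])
  exact Subgroup.inclusion_injective h (F.injective hψ this)

theorem homImage_sup {Q R T B : Subgroup G} {ψ : ↥(Q ⊔ R) →* B} {α : MulAut Q}
    {φ : R →* T} (hα : Restricts ψ (MulEquiv.toMonoidHom α)) (hφ : Restricts ψ φ) :
    homImage ψ = Q ⊔ homImage φ := by
  obtain ⟨h₁, hα⟩ := hα
  obtain ⟨h₂, hφ⟩ := hφ
  apply le_antisymm
  · have key : Q ⊔ R ≤
        ((Q ⊔ homImage φ).comap (B.subtype.comp ψ)).map (Q ⊔ R).subtype := by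
      refine sup_le (fun x hx => ⟨⟨x, h₁ hx⟩, ?_, rfl⟩) (fun x hx => ⟨⟨x, h₂ hx⟩, ?_, rfl⟩)
      · have e : (ψ ⟨x, h₁ hx⟩ : G) = (α ⟨x, hx⟩ : G) := hα ⟨x, hx⟩
        have : (ψ ⟨x, h₁ hx⟩ : G) ∈ Q ⊔ homImage φ :=
          Subgroup.mem_sup_left (e ▸ (α ⟨x, hx⟩).2)
        exact this
      · have : (ψ ⟨x, h₂ hx⟩ : G) ∈ Q ⊔ homImage φ :=
          Subgroup.mem_sup_right ⟨⟨x, hx⟩, (hφ ⟨x, hx⟩).symm⟩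
        exact this
    rintro _ ⟨x, rfl⟩
    obtain ⟨y, hy, hyx⟩ := key x.2
    have : y = x := Subtype.ext hyx
    subst this
    exact hy
  · refine sup_le (fun x hx => ?_) ?_
    · refine ⟨Subgroup.inclusion h₁ (α.symm ⟨x, hx⟩), ?_⟩
      refine (hα _).trans ?_
      simp
    · rintro _ ⟨x, rfl⟩
      exact ⟨Subgroup.inclusion h₂ x, hφ x⟩

/-- For a subgroup `Q` of the base `S` and a group `X` of automorphisms of `Q`: the category on
`N_S(Q)` whose morphisms are all homomorphisms `φ : R → T`, `R, T ≤ N_S(Q)`, for which there is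
a morphism `ψ : QR → QT` of `F` with `ψ|_Q ∈ X` and `ψ|_R = φ` (so `φ` is itself in `F`). -/
def autNormalizer (F : CategoryOn G) (Q : Subgroup G) (hQ : Q ≤ F.base)
    (X : Subgroup (MulAut Q)) : CategoryOn G where
  base := F.baseNormalizer Q
  Hom R T := {φ | R ≤ F.baseNormalizer Q ∧ T ≤ F.baseNormalizer Q ∧
    ∃ ψ ∈ F.Hom (Q ⊔ R) (Q ⊔ T),
      (∃ α ∈ X, Restricts ψ (MulEquiv.toMonoidHom α)) ∧ Restricts ψ φ}
  le_base h := ⟨h.1, h.2.1⟩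
  injective := by
    rintro P R φ ⟨-, -, ψ, hψ, -, h⟩
    exact F.inj_of_restricts h hψ
  inclusion_mem := by
    intro P R h hR
    refine ⟨h.trans hR, hR, _,
      F.inclusion_mem (sup_le_sup_left h Q) (sup_le hQ (hR.trans inf_le_left)),
      ⟨1, one_mem _, le_sup_left, fun x => rfl⟩, le_sup_right, fun x => rfl⟩
  comp_mem := by
    rintro P R T φ χ ⟨hP, hR, ψ, hψ, ⟨α, hα, h₁, h₂⟩, h₃, h₄⟩
      ⟨-, hT, ψ', hψ', ⟨α', hα', h₁', h₂'⟩, h₃', h₄'⟩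
    refine ⟨hP, hT, _, F.comp_mem hψ hψ', ⟨α' * α, mul_mem hα' hα, h₁, fun x => ?_⟩, h₃,
      fun x => ?_⟩
    · have e : ψ (Subgroup.inclusion h₁ x) = Subgroup.inclusion h₁' (α x) :=
        Subtype.ext (h₂ x)
      have := h₂' (α x)
      rw [← e] at this
      exact this
    · have e : ψ (Subgroup.inclusion h₃ x) = Subgroup.inclusion h₃' (φ x) :=
        Subtype.ext (h₄ x)
      have := h₄' (φ x)
      rw [← e] at this
      exact this
  image_mem := by
    rintro P R φ ⟨hP, hR, ψ, hψ, ⟨α, hα, h₁⟩, h₃⟩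
    have hI := homImage_sup h₁ h₃
    have hb : homImage φ ≤ F.baseNormalizer Q := (homImage_le φ).trans hR
    refine ⟨hP, hb, _, F.comp_mem (F.image_mem hψ)
      (F.inclusion_mem hI.le (sup_le hQ (hb.trans inf_le_left))), ⟨α, hα, h₁.1, fun x => ?_⟩,
      h₃.1, fun x => ?_⟩
    · exact h₁.2 x
    · exact h₃.2 x
  image_symm_mem := by
    rintro P R φ ⟨hP, hR, ψ, hψ, ⟨α, hα, h₁⟩, h₃⟩
    have hI := homImage_sup h₁ h₃
    have hb : homImage φ ≤ F.baseNormalizer Q := (homImage_le φ).trans hR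
    have hφ := F.inj_of_restricts h₃ hψ
    refine ⟨hb, hP, _, F.comp_mem
      (F.inclusion_mem hI.ge ((homImage_le ψ).trans (F.le_base hψ).2)) (F.image_symm_mem hψ),
      ⟨α⁻¹, inv_mem hα, le_sup_left, fun x => ?_⟩, le_sup_right, fun x => ?_⟩
    · obtain ⟨y, rfl⟩ := α.surjective x
      have e : (homImageEquiv ψ (F.injective hψ)).symm
          (Subgroup.inclusion hI.ge (Subgroup.inclusion le_sup_left (α y))) =
          Subgroup.inclusion h₁.1 y := by
        rw [MulEquiv.symm_apply_eq]
        exact Subtype.ext (h₁.2 y).symm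
      refine (congrArg Subtype.val e).trans ?_
      change (y : G) = ((α⁻¹ (α y) : Q) : G)
      rw [MulAut.inv_apply_self]
    · obtain ⟨y, rfl⟩ := (homImageEquiv φ hφ).surjective x
      have e : (homImageEquiv ψ (F.injective hψ)).symm
          (Subgroup.inclusion hI.ge (Subgroup.inclusion le_sup_right (homImageEquiv φ hφ y))) =
          Subgroup.inclusion h₃.1 y := by
        rw [MulEquiv.symm_apply_eq]
        exact Subtype.ext (h₃.2 y).symm
      refine (congrArg Subtype.val e).trans ?_
      change (y : G) = (((homImageEquiv φ hφ).symm (homImageEquiv φ hφ y) : P) : G)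
      rw [MulEquiv.symm_apply_apply]

/-- The normalizer `N_F(Q)` of `Q` in `F`, a category on `N_S(Q)`: morphisms `φ : R → T` with an
extension `ψ : QR → QT` in `F` such that `ψ|_Q ∈ Aut_F(Q)`. -/
def normalizer (F : CategoryOn G) (Q : Subgroup G) (hQ : Q ≤ F.base) : CategoryOn G :=
  F.autNormalizer Q hQ (F.autF Q hQ)

/-- The category `N_S(Q) C_F(Q)` on `N_S(Q)`: morphisms `φ : R → T` with an extension
`ψ : QR → QT` in `F` such that `ψ|_Q` is conjugation by an element of `N_S(Q)`.
When `Q` is normal in `S` this is `S C_F(Q)`, a category on `S`. -/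
def normalizerCentralizer (F : CategoryOn G) (Q : Subgroup G) (hQ : Q ≤ F.base) : CategoryOn G :=
  F.autNormalizer Q hQ (F.autBase Q)

/-- `Q ≤ S` is normal in `F`: `F = N_F(Q)`. -/
def IsNormal (F : CategoryOn G) (Q : Subgroup G) : Prop :=
  ∃ hQ : Q ≤ F.base, F = F.normalizer Q hQ

/-- `O_p(F)`, the largest subgroup of `S` normal in `F` (see `isGreatest_core`). -/
def core (F : CategoryOn G) : Subgroup G :=
  sSup {Q | F.IsNormal Q}

theorem mem_of_restricts (F : CategoryOn G) {A B P Q : Subgroup G} {ψ : A →* B} {φ : P →* Q}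
    (h : Restricts ψ φ) (hψ : ψ ∈ F.Hom A B) (hQ : Q ≤ F.base) : φ ∈ F.Hom P Q := by
  obtain ⟨h₁, h₂⟩ := h
  have hχ := F.comp_mem (F.inclusion_mem h₁ (F.le_base hψ).1) hψ
  have hle : homImage (ψ.comp (Subgroup.inclusion h₁)) ≤ Q := by
    rintro _ ⟨x, rfl⟩
    have e : (ψ (Subgroup.inclusion h₁ x) : G) = φ x := h₂ x
    have : (ψ (Subgroup.inclusion h₁ x) : G) ∈ Q := e ▸ (φ x).2
    exact this
  have := F.comp_mem (F.image_mem hχ) (F.inclusion_mem hle hQ)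
  convert this using 1
  ext x
  exact (h₂ x).symm

theorem isNormal_of (F : CategoryOn G) {Q : Subgroup G} (hQ : Q ≤ F.base)
    (hN : F.base ≤ Subgroup.normalizer (Q : Set G))
    (H : ∀ (R T : Subgroup G) (φ : R →* T), φ ∈ F.Hom R T → ∃ ψ ∈ F.Hom (Q ⊔ R) (Q ⊔ T),
      (∃ α ∈ F.autF Q hQ, Restricts ψ (MulEquiv.toMonoidHom α)) ∧ Restricts ψ φ) :
    F.IsNormal Q := by
  have hb : F.baseNormalizer Q = F.base := inf_eq_left.2 hN
  refine ⟨hQ, CategoryOn.ext hb.symm ?_⟩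
  funext R T
  ext φ
  constructor
  · intro hφ
    have := F.le_base hφ
    exact ⟨this.1.trans hb.ge, this.2.trans hb.ge, H R T φ hφ⟩
  · rintro ⟨-, hT, ψ, hψ, -, h⟩
    exact F.mem_of_restricts h hψ (hT.trans hb.le)

theorem IsNormal.le_normalizer {F : CategoryOn G} {Q : Subgroup G} (h : F.IsNormal Q) :
    F.base ≤ Subgroup.normalizer (Q : Set G) := by
  obtain ⟨hQ, h⟩ := h
  have : F.base = F.baseNormalizer Q := congrArg CategoryOn.base h
  exact this.le.trans inf_le_right

theorem IsNormal.extend {F : CategoryOn G} {Q : Subgroup G} (h : F.IsNormal Q)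
    {R T : Subgroup G} {φ : R →* T} (hφ : φ ∈ F.Hom R T) : ∃ ψ ∈ F.Hom (Q ⊔ R) (Q ⊔ T),
      (∃ α ∈ F.autF Q h.1, Restricts ψ (MulEquiv.toMonoidHom α)) ∧ Restricts ψ φ := by
  obtain ⟨hQ, h⟩ := h
  have : φ ∈ (F.normalizer Q hQ).Hom R T := h ▸ hφ
  exact this.2.2

theorem isNormal_bot (F : CategoryOn G) : F.IsNormal ⊥ := by
  refine F.isNormal_of bot_le ?_ ?_
  · intro x _
    rw [Subgroup.mem_normalizer_iff]
    intro h
    simp [Subgroup.mem_bot]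
  · intro R T φ hφ
    have hb := F.le_base hφ
    refine ⟨_, F.comp_mem (F.inclusion_mem (bot_sup_eq R).le hb.1)
      (F.comp_mem hφ (F.inclusion_mem (bot_sup_eq T).ge (sup_le bot_le hb.2))),
      ⟨1, one_mem _, bot_le, fun x => ?_⟩, le_sup_right, fun x => rfl⟩
    obtain rfl := Subsingleton.elim 1 x
    simp

theorem IsNormal.sup {F : CategoryOn G} {Q Q' : Subgroup G} (h : F.IsNormal Q)
    (h' : F.IsNormal Q') : F.IsNormal (Q ⊔ Q') := by
  have hM : Q ⊔ Q' ≤ F.base := sup_le h.1 h'.1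
  refine F.isNormal_of hM ?_ ?_
  · intro x hx
    rw [Subgroup.mem_normalizer_iff_conj_image_eq]
    have e (P : Subgroup G) (hP : F.IsNormal P) : P.map (MulAut.conj x).toMonoidHom = P :=
      SetLike.coe_injective
        (Subgroup.mem_normalizer_iff_conj_image_eq.1 (hP.le_normalizer hx))
    have := Subgroup.map_sup Q Q' (MulAut.conj x).toMonoidHom
    rw [e Q h, e Q' h'] at this
    exact congrArg (fun P : Subgroup G => (P : Set G)) this
  · intro R T φ hφ
    have hb := F.le_base hφ
    obtain ⟨ψ, hψ, ⟨α, hα, h₁⟩, h₂⟩ := h.extend hφ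
    obtain ⟨ψ', hψ', ⟨α', hα', h₁'⟩, h₂'⟩ := h'.extend hψ
    have d : (Q ⊔ Q') ⊔ R ≤ Q' ⊔ (Q ⊔ R) := by
      rw [sup_comm Q Q', sup_assoc]
    have c : Q' ⊔ (Q ⊔ T) ≤ (Q ⊔ Q') ⊔ T := by
      rw [sup_comm Q Q', sup_assoc]
    have hθ := F.comp_mem (F.inclusion_mem d (F.le_base hψ').1)
      (F.comp_mem hψ' (F.inclusion_mem c (sup_le hM hb.2)))
    have hχ := F.comp_mem (F.inclusion_mem (le_sup_left (a := Q ⊔ Q') (b := R))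
      (sup_le hM hb.1)) hθ
    set θ := ((Subgroup.inclusion c).comp ψ').comp (Subgroup.inclusion d) with hθdef
    set χ := θ.comp (Subgroup.inclusion (le_sup_left (a := Q ⊔ Q') (b := R))) with hχdef
    have r : Restricts ψ' (MulEquiv.toMonoidHom α) :=
      ⟨h₁.1.trans h₂'.1, fun x => (h₂'.2 (Subgroup.inclusion h₁.1 x)).trans (h₁.2 x)⟩
    have r₁ : Restricts χ (MulEquiv.toMonoidHom α) := ⟨le_sup_left, fun x => r.2 x⟩
    have r₂ : Restricts χ (MulEquiv.toMonoidHom α') := ⟨le_sup_right, fun x => h₁'.2 x⟩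
    have hI : homImage χ = Q ⊔ Q' := by
      rw [homImage_sup r₁ r₂]
      congr 1
      ext x
      constructor
      · exact fun hx => homImage_le _ hx
      · exact fun hx => ⟨α'.symm ⟨x, hx⟩, by simp⟩
    refine ⟨θ, hθ, ⟨(homImageEquiv χ (F.injective hχ)).trans (MulEquiv.subgroupCongr hI), ?_,
      le_sup_left, fun x => rfl⟩, le_sup_right, fun x => ?_⟩
    · exact F.comp_mem (F.image_mem hχ) (F.inclusion_mem hI.le hM)
    · exact (h₂'.2 (Subgroup.inclusion h₂.1 x)).trans (h₂.2 x)

/-- If `S` is finite, `O_p(F)` is indeed the largest subgroup of `S` that is normal in `F`. -/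
theorem isGreatest_core (F : CategoryOn G) (hfin : Finite F.base) :
    IsGreatest {Q | F.IsNormal Q} F.core := by
  have hf : {Q | F.IsNormal Q}.Finite := by
    refine (Set.finite_range (Subgroup.map F.base.subtype)).subset fun Q hQ => ?_
    exact ⟨Q.subgroupOf F.base, by rw [Subgroup.map_subgroupOf_eq_of_le hQ.1]⟩
  obtain ⟨M, hM⟩ := hf.exists_maximal ⟨⊥, F.isNormal_bot⟩
  have hg : IsGreatest {Q | F.IsNormal Q} M :=
    ⟨hM.prop, fun Q hQ => le_sup_right.trans (hM.le_of_ge (hM.prop.sup hQ) le_sup_left)⟩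
  have : F.core = M := hg.isLUB.sSup_eq
  exact this ▸ hg

theorem core_le_base (F : CategoryOn G) : F.core ≤ F.base :=
  sSup_le fun _ hQ => hQ.1

/-- `O_p(F) C_S(O_p(F))`. -/
def coreCentralizer (F : CategoryOn G) : Subgroup G :=
  F.core ⊔ F.baseCentralizer F.core

theorem coreCentralizer_le_base (F : CategoryOn G) : F.coreCentralizer ≤ F.base :=
  sup_le F.core_le_base inf_le_left

/-- Inclusion of categories on subgroups of `G`. -/
instance : LE (CategoryOn G) where
  le E F := E.base ≤ F.base ∧ ∀ P Q : Subgroup G, E.Hom P Q ⊆ F.Hom P Q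

/-- `⟨F₁, F₂⟩`: the smallest category containing `F₁` and `F₂`. If `F₁` and `F₂` are categories
on `S`, then so is `⟨F₁, F₂⟩`. -/
def generated (F₁ F₂ : CategoryOn G) : CategoryOn G where
  base := F₁.base ⊔ F₂.base
  Hom P Q := {φ | P ≤ F₁.base ⊔ F₂.base ∧ Q ≤ F₁.base ⊔ F₂.base ∧ Function.Injective φ ∧
    ∀ E : CategoryOn G, F₁ ≤ E → F₂ ≤ E → φ ∈ E.Hom P Q}
  le_base h := ⟨h.1, h.2.1⟩
  injective h := h.2.2.1
  inclusion_mem h hQ := ⟨h.trans hQ, hQ, Subgroup.inclusion_injective h,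
    fun E h₁ h₂ => E.inclusion_mem h (hQ.trans (sup_le h₁.1 h₂.1))⟩
  comp_mem h h' := ⟨h.1, h'.2.1, h'.2.2.1.comp h.2.2.1,
    fun E h₁ h₂ => E.comp_mem (h.2.2.2 E h₁ h₂) (h'.2.2.2 E h₁ h₂)⟩
  image_mem h := ⟨h.1, (homImage_le _).trans h.2.1, MulEquiv.injective _,
    fun E h₁ h₂ => E.image_mem (h.2.2.2 E h₁ h₂)⟩
  image_symm_mem h := ⟨(homImage_le _).trans h.2.1, h.1, MulEquiv.injective _,
    fun E h₁ h₂ => E.image_symm_mem (h.2.2.2 E h₁ h₂)⟩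

end CategoryOn

/-! Of `Q = O_p(F)` the argument needs only that it is normal in `F`. A morphism `φ : P → T`
therefore extends to `θ : QP → QT` with `θ|_Q = α ∈ Aut_F(Q)`. If some `ω` in `F`, defined on `PR`
with `R = Q C_S(Q)`, maps `R` to itself and agrees with `α` on `Q`, then `ω|_{QP}` lies in `N_F(R)`,
while `θ ∘ (ω|_{QP})⁻¹` is the identity on `Q` and so lies in `S C_F(Q)`. Their composite is `θ`,
whose restriction is `φ`.

To find `ω`, first extend `α` to some `β ∈ Aut_F(R)`; this is possible because `N_α` contains both
`Q` and `C_S(Q)` (`exists_autF_sup_baseCentralizer`). Next, `β` must be corrected until it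
conjugates the action of `QP` on `R` into `Aut_S(R)`, after which the extension axiom at `R` yields
`ω`. Let `K` be the group of elements of `Aut_F(R)` that are trivial on `Q`. For `x ∈ QP`, the
automorphisms `β c_x β⁻¹` and `c_{θ(x)}` agree on `Q`, so `β` conjugates the action of `QP` into
`Aut_S(R) K`. There `Aut_S(R)` is a Sylow `p`-subgroup, so some `κ ∈ K` moves that conjugate into
`Aut_S(R)`, and `κβ` still restricts to `α` (`exists_autF_conj`).

The Sylow property rests on `mem_autBase_of_normalizes`: a `p`-element normalizing `Aut_S(R)`
extends to an automorphism of `S`, and there the Sylow axiom of a fusion system applies. -/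

/-! ### Sylow arguments in finite groups -/

/-- A `p`-subgroup that contains every `p`-element normalizing it is a Sylow `p`-subgroup. -/
theorem exists_sylow_eq_of_normalizer {L : Type*} [Group L] [Finite L] {p : ℕ} [Fact p.Prime]
    {A : Subgroup L} (hA : IsPGroup p A)
    (h : ∀ x : L, (∃ k, x ^ p ^ k = 1) → (∀ a, a ∈ A ↔ x * a * x⁻¹ ∈ A) → x ∈ A) :
    ∃ T : Sylow p L, (T : Subgroup L) = A := by
  obtain ⟨T, hT⟩ := hA.exists_le_sylow
  refine ⟨T, le_antisymm ?_ hT⟩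
  have : Group.IsNilpotent T := T.isPGroup'.isNilpotent
  -- In the nilpotent group `T` only `T` itself is self-normalizing, so it suffices that `N_T(A) =
  -- A`. All elements of `T` are `p`-elements, so `h` gives this.
  have hn := (normalizerCondition_iff_only_full_group_self_normalizing).1
    (Group.normalizerCondition_of_isNilpotent (G := T)) (A.subgroupOf T) ?_
  · exact Subgroup.subgroupOf_eq_top.1 hn
  refine le_antisymm (fun x hx => ?_) Subgroup.le_normalizer
  rw [Subgroup.mem_normalizer_iff] at hx
  refine Subgroup.mem_subgroupOf.2 (h x ?_ fun a => ⟨fun ha => ?_, fun ha => ?_⟩)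
  · obtain ⟨k, hk⟩ := T.isPGroup' x
    exact ⟨k, by simpa using congrArg Subtype.val hk⟩
  · exact (hx ⟨a, hT ha⟩).1 ha
  · have haT : a ∈ (T : Subgroup L) := by
      have := mul_mem (mul_mem (inv_mem x.2) (hT ha)) x.2
      simpa [mul_assoc] using this
    exact (hx ⟨a, haT⟩).2 ha

open scoped Pointwise in
/-- If `A` normalizes `K` and contains all `p`-elements of `KA` normalizing it, then each
`p`-subgroup of `KA` is conjugate into `A` by an element of `K`. -/
theorem exists_conj_mem_of_le_sup {M : Type*} [Group M] [Finite M] {p : ℕ} [Fact p.Prime]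
    {A K D : Subgroup M} (hA : IsPGroup p A) (hAK : A ≤ Subgroup.normalizer (K : Set M))
    (hD : IsPGroup p D) (hDL : D ≤ A ⊔ K)
    (h : ∀ x ∈ A ⊔ K, (∃ k, x ^ p ^ k = 1) → (∀ a, a ∈ A ↔ x * a * x⁻¹ ∈ A) → x ∈ A) :
    ∃ k ∈ K, ∀ d ∈ D, k * d * k⁻¹ ∈ A := by
  have hAL : A ≤ A ⊔ K := le_sup_left
  obtain ⟨T, hT⟩ := exists_sylow_eq_of_normalizer (L := ↥(A ⊔ K)) (A := A.subgroupOf (A ⊔ K))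
    (hA.of_equiv (Subgroup.subgroupOfEquivOfLe hAL).symm) (fun x hx hn => by
      refine Subgroup.mem_subgroupOf.2 (h x x.2 ?_ fun a => ⟨fun ha => ?_, fun ha => ?_⟩)
      · obtain ⟨k, hk⟩ := hx
        exact ⟨k, by simpa using congrArg Subtype.val hk⟩
      · exact (hn ⟨a, hAL ha⟩).1 ha
      · have haL : a ∈ A ⊔ K := by
          have := mul_mem (mul_mem (inv_mem x.2) (hAL ha)) x.2
          simpa [mul_assoc] using this
        exact (hn ⟨a, haL⟩).2 ha)
  obtain ⟨T', hT'⟩ := (hD.of_equiv (Subgroup.subgroupOfEquivOfLe hDL).symm).exists_le_sylow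
  obtain ⟨g, hg⟩ := MulAction.exists_smul_eq ↥(A ⊔ K) T' T
  have hgL : (g : M) ∈ (A : Set M) * (K : Set M) := by
    rw [← Subgroup.coe_mul_of_left_le_normalizer_right A K hAK]
    exact g.2
  -- The factor `a ∈ A` of the Sylow conjugator `g = ak` normalizes `A`, so `k` alone already
  -- conjugates `D` into `A`.
  obtain ⟨a, ha, k, hk, hak⟩ := hgL
  refine ⟨k, hk, fun d hd => ?_⟩
  have hd' : (⟨d, hDL hd⟩ : ↥(A ⊔ K)) ∈ (T' : Subgroup ↥(A ⊔ K)) := hT' hd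
  have hc : g * ⟨d, hDL hd⟩ * g⁻¹ ∈ (T : Subgroup ↥(A ⊔ K)) := by
    rw [← hg]
    exact ⟨_, hd', rfl⟩
  rw [hT] at hc
  have hc' : (g : M) * d * (g : M)⁻¹ ∈ A := hc
  rw [← hak] at hc'
  have := mul_mem (mul_mem (inv_mem ha) hc') ha
  convert this using 1
  simp only
  group

/-- An element of `p`-power order lies in a subgroup as soon as a power with exponent prime to
`p` does. -/
theorem mem_of_pow_mem_of_not_dvd {M : Type*} [Group M] {p : ℕ} [hp : Fact p.Prime]
    {A : Subgroup M} {x : M} {k m : ℕ} (hx : x ^ p ^ k = 1) (hm : ¬ p ∣ m) (h : x ^ m ∈ A) :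
    x ∈ A := by
  have hc : (p ^ k).Coprime m := Nat.Coprime.pow_left _ ((hp.out.coprime_iff_not_dvd).2 hm)
  have e : x = (x ^ m) ^ (Nat.gcdB (p ^ k) m) := by
    have := Nat.gcd_eq_gcd_ab (p ^ k) m
    rw [hc.gcd_eq_one] at this
    calc x = x ^ ((1 : ℕ) : ℤ) := by simp
      _ = _ := by rw [this, zpow_add, zpow_mul, zpow_mul, zpow_natCast, zpow_natCast, hx, one_zpow,
        one_mul]
  rw [e]
  exact zpow_mem h _

/-! ### Automizers and extensions for subgroups normal in the base -/

namespace CategoryOn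

variable {G : Type*} [Group G]

theorem exists_mulAut_of_mem_normalizer {P : Subgroup G} {x : G}
    (hx : x ∈ Subgroup.normalizer (P : Set G)) :
    ∃ c : MulAut P, ∀ u : P, (c u : G) = x * u * x⁻¹ :=
  ⟨P.normalizerMonoidHom ⟨x, hx⟩, fun _ => rfl⟩

theorem isPGroup_autBase {F : CategoryOn G} {p : ℕ} (hS : IsPGroup p F.base) {P : Subgroup G}
    (hP : F.base ≤ Subgroup.normalizer (P : Set G)) : IsPGroup p (F.autBase P) := by
  refine (hS.of_surjective
    (P.normalizerMonoidHom.comp (Subgroup.inclusion hP)).rangeRestrict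
    (MonoidHom.rangeRestrict_surjective _)).to_le ?_
  rintro α ⟨x, hx, h⟩
  refine ⟨⟨x, hx⟩, ?_⟩
  ext u
  exact (h u).symm

theorem autBase_le_autF {F : CategoryOn G} {p : ℕ} (hF : F.IsFusionSystem p F.base)
    {P : Subgroup G} (hP : P ≤ F.base) : F.autBase P ≤ F.autF P hP := by
  rintro α ⟨x, hx, h⟩
  exact hF.conj_mem x hx P P hP hP _ h

/-- An injective endomorphism in `F` of a finite subgroup is an element of `Aut_F(P)`. -/
theorem exists_autF_of_hom {F : CategoryOn G} {P : Subgroup G} (hP : P ≤ F.base) [Finite P]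
    {ψ : P →* P} (hψ : ψ ∈ F.Hom P P) : ∃ α ∈ F.autF P hP, ∀ x, α x = ψ x :=
  ⟨MulEquiv.ofBijective ψ (Finite.injective_iff_bijective.1 (F.injective hψ)), hψ, fun _ => rfl⟩

theorem homImage_mulAut {P : Subgroup G} (α : MulAut P) :
    homImage (MulEquiv.toMonoidHom α) = P :=
  le_antisymm (homImage_le _) fun x hx => ⟨α.symm ⟨x, hx⟩, by simp⟩

theorem homImage_comp_inclusion_mulAut {P T : Subgroup G} (α : MulAut P) (h : P ≤ T) :
    homImage ((Subgroup.inclusion h).comp (MulEquiv.toMonoidHom α)) = P :=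
  homImage_mulAut α

/-- `N_S(P) = S` has the largest order possible. This makes the extension axiom available for every
element of `Aut_F(P)`. -/
theorem fullyNormalized_of_le_normalizer {F : CategoryOn G} [Finite F.base] {P : Subgroup G}
    (hP : P ≤ F.base) (hN : F.base ≤ Subgroup.normalizer (P : Set G)) : F.FullyNormalized P := by
  refine ⟨hP, fun P' _ => ?_⟩
  have h : F.baseNormalizer P = F.base := inf_eq_left.2 hN
  rw [h]
  exact Subgroup.card_le_of_le inf_le_left

/-- The extension axiom for an automorphism `α` of a subgroup `P` normal in the base: it extends
to any subgroup `X` whose action on `P` is conjugated by `α` into the action of the base. -/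
theorem exists_extension {F : CategoryOn G} {p : ℕ} (hF : F.IsFusionSystem p F.base)
    {P X Y : Subgroup G} (hP : P ≤ F.base) (hN : F.base ≤ Subgroup.normalizer (P : Set G))
    {α : MulAut P} (hα : α ∈ F.autF P hP) (hX : X ≤ F.base) (hY : Y ≤ F.base)
    (h : ∀ x ∈ (X : Set G) ∪ Y, ∃ y ∈ F.base,
      ∀ u v : P, (v : G) = x * u * x⁻¹ → (α v : G) = y * α u * y⁻¹) :
    ∃ ψ ∈ F.Hom (X ⊔ Y) F.base, ∀ (u : G) (hu : u ∈ P) (hu' : u ∈ X ⊔ Y),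
      (ψ ⟨u, hu'⟩ : G) = α ⟨u, hu⟩ := by
  have : Finite F.base := hF.finite
  have hi := homImage_comp_inclusion_mulAut α hP
  obtain ⟨ψ, hψ, hψP, hr⟩ := hF.extension P _
    (F.comp_mem (φ := MulEquiv.toMonoidHom α) hα (F.inclusion_mem hP le_rfl))
    (by rw [hi]; exact fullyNormalized_of_le_normalizer hP hN)
  have hb : F.baseNormalizer P = F.base := inf_eq_left.2 hN
  have hle : X ⊔ Y ≤ F.extensionDomain ((Subgroup.inclusion hP).comp (MulEquiv.toMonoidHom α)) := by
    -- `N_φ` is a subgroup, so membership need only be checked on the generators `X ∪ Y`.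
    have key : ∀ x ∈ F.base, x ∈ (X : Set G) ∪ Y →
        x ∈ F.extensionDomain ((Subgroup.inclusion hP).comp (MulEquiv.toMonoidHom α)) := by
      intro x hx hxy
      obtain ⟨y, hy, h⟩ := h x hxy
      refine ⟨hb.ge hx, y, ?_, h⟩
      rw [hi]
      exact hb.ge hy
    exact sup_le (fun x hx => key x (hX hx) (Or.inl hx)) (fun x hx => key x (hY hx) (Or.inr hx))
  exact ⟨_, F.comp_mem (F.inclusion_mem hle (F.le_base hψ).1) hψ, fun u hu hu' => hr ⟨u, hu⟩⟩

/-- A `p`-element of `Aut_F(P)`, `P` normal in the base `S`, that normalizes `Aut_S(P)` lies in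
`Aut_S(P)`. -/
theorem mem_autBase_of_normalizes {F : CategoryOn G} {p : ℕ} [Fact p.Prime]
    (hF : F.IsFusionSystem p F.base) {P : Subgroup G} (hP : P ≤ F.base)
    (hN : F.base ≤ Subgroup.normalizer (P : Set G)) {τ : MulAut P} (hτ : τ ∈ F.autF P hP)
    (hp : ∃ k, τ ^ p ^ k = 1) (h : ∀ a, a ∈ F.autBase P ↔ τ * a * τ⁻¹ ∈ F.autBase P) :
    τ ∈ F.autBase P := by
  have hfin : Finite F.base := hF.finite
  -- Since `τ` normalizes `Aut_S(P)`, its extension domain is all of `S`. The extension is thus an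
  -- automorphism `σ` of `S`.
  obtain ⟨ψ, hψ, hψτ⟩ := exists_extension hF (X := F.base) (Y := F.base) hP hN hτ le_rfl le_rfl
    (fun x hx => by
      have hx : x ∈ F.base := hx.elim id id
      obtain ⟨c, hc⟩ := exists_mulAut_of_mem_normalizer (hN hx)
      obtain ⟨y, hy, hyc⟩ := (h c).1 ⟨x, hx, hc⟩
      refine ⟨y, hy, fun u v huv => ?_⟩
      have hv : v = c u := Subtype.ext (huv.trans (hc u).symm)
      have := hyc (τ u)
      rw [MulAut.mul_apply, MulAut.mul_apply, MulAut.inv_apply_self] at this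
      rw [hv, this])
  have hle : F.base ≤ F.base ⊔ F.base := le_sup_left
  obtain ⟨σ, hσ, hσψ⟩ := exists_autF_of_hom le_rfl
    (F.comp_mem (F.inclusion_mem hle (F.le_base hψ).1) hψ)
  have hστ : ∀ u : P, (σ ⟨u, hP u.2⟩ : G) = τ u := fun u =>
    (congrArg Subtype.val (hσψ _)).trans (hψτ u u.2 (hle (hP u.2)))
  have hpow : ∀ (n : ℕ) (u : P), ((σ ^ n) ⟨u, hP u.2⟩ : G) = (τ ^ n) u := by
    intro n
    induction n with
    | zero => intro u; simp
    | succ n ih =>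
      intro u
      have e : σ ⟨u, hP u.2⟩ = ⟨τ u, hP (τ u).2⟩ := Subtype.ext (hστ u)
      rw [pow_succ, pow_succ, MulAut.mul_apply, MulAut.mul_apply, e, ih]
  obtain ⟨k, hk⟩ := hp
  obtain ⟨-, T, hT⟩ := hF.sylow
  -- `Aut_S(S)` consists of the inner automorphisms, and `β c_x β⁻¹ = c_{β(x)}`. Normality is what
  -- puts the power of `σ` by the index inside `Aut_S(S)`.
  have hnor : (F.autBase F.base).Normal := ⟨by
    rintro a ⟨x, hx, hxa⟩ β
    refine ⟨β ⟨x, hx⟩, (β _).2, fun u => ?_⟩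
    have e : a (β⁻¹ u) = ⟨x, hx⟩ * β⁻¹ u * ⟨x, hx⟩⁻¹ := Subtype.ext (hxa _)
    rw [MulAut.mul_apply, MulAut.mul_apply, e, map_mul, map_mul, map_inv, MulAut.apply_inv_self]
    rfl⟩
  have hdvd : ¬ p ∣ (F.autBase F.base).relIndex (F.autF F.base hF.base_eq.ge) := by
    have := T.not_dvd_index
    rwa [hT] at this
  -- With `m`, prime to `p`, the index of `Aut_S(S)` in `Aut_F(S)`, the power `σ ^ m` is conjugation
  -- by some `x ∈ S`. Restricting to `P` shows that `τ ^ m ∈ Aut_S(P)`, which suffices because `τ`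
  -- is a `p`-element; `σ` need not be one.
  refine mem_of_pow_mem_of_not_dvd hk hdvd ?_
  have hm := Subgroup.pow_index_mem ((F.autBase F.base).subgroupOf (F.autF F.base hF.base_eq.ge))
    ⟨σ, hσ⟩
  obtain ⟨x, hx, hxσ⟩ := Subgroup.mem_subgroupOf.1 hm
  refine ⟨x, hx, fun u => ?_⟩
  rw [← hpow]
  exact hxσ _

/-- The witness may have any domain and codomain: restricted to `QR` it has image `Q φ(R) ≤ QT`. -/
theorem mem_autNormalizer_of_restricts {F : CategoryOn G} {Q : Subgroup G} (hQ : Q ≤ F.base)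
    {X : Subgroup (MulAut Q)} {R T A B : Subgroup G} {φ : R →* T} {ψ : A →* B}
    (hR : R ≤ F.baseNormalizer Q) (hT : T ≤ F.baseNormalizer Q) (hψ : ψ ∈ F.Hom A B)
    {α : MulAut Q} (hα : α ∈ X) (h₁ : Restricts ψ (MulEquiv.toMonoidHom α))
    (h₂ : Restricts ψ φ) : φ ∈ (F.autNormalizer Q hQ X).Hom R T := by
  obtain ⟨h₁, h₁'⟩ := h₁
  obtain ⟨h₂, h₂'⟩ := h₂
  have hle : Q ⊔ R ≤ A := sup_le h₁ h₂
  have hχ := F.comp_mem (F.inclusion_mem hle (F.le_base hψ).1) hψ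
  have r₁ : Restricts (ψ.comp (Subgroup.inclusion hle)) (MulEquiv.toMonoidHom α) :=
    ⟨le_sup_left, h₁'⟩
  have r₂ : Restricts (ψ.comp (Subgroup.inclusion hle)) φ := ⟨le_sup_right, h₂'⟩
  have hI : homImage (ψ.comp (Subgroup.inclusion hle)) ≤ Q ⊔ T :=
    (homImage_sup r₁ r₂).le.trans (sup_le_sup_left (homImage_le φ) Q)
  exact ⟨hR, hT, _, F.comp_mem (F.image_mem hχ) (F.inclusion_mem hI
    (sup_le hQ (hT.trans inf_le_left))), ⟨α, hα, r₁⟩, r₂⟩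

/-! ### Extending automorphisms from `Q` to `Q C_S(Q)` -/

/-- `O_p(F) C_S(O_p(F))` is normal in the base. -/
theorem le_normalizer_sup_baseCentralizer (F : CategoryOn G) {Q : Subgroup G}
    (hN : F.base ≤ Subgroup.normalizer (Q : Set G)) :
    F.base ≤ Subgroup.normalizer ((Q ⊔ F.baseCentralizer Q : Subgroup G) : Set G) := by
  have key : ∀ x ∈ F.base, ∀ u ∈ Q ⊔ F.baseCentralizer Q,
      x * u * x⁻¹ ∈ Q ⊔ F.baseCentralizer Q := by
    intro x hx
    have : Q ⊔ F.baseCentralizer Q ≤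
        (Q ⊔ F.baseCentralizer Q).comap (MulAut.conj x).toMonoidHom := by
      refine sup_le (fun u hu => ?_) (fun u hu => ?_)
      · exact Subgroup.mem_sup_left ((Subgroup.mem_normalizer_iff.1 (hN hx) u).1 hu)
      · refine Subgroup.mem_sup_right ⟨F.base.mul_mem (F.base.mul_mem hx hu.1) (F.base.inv_mem hx), ?_⟩
        refine Subgroup.mem_centralizer_iff.2 fun q hq => ?_
        have hq' : x⁻¹ * q * x ∈ (Q : Set G) :=
          (Subgroup.mem_normalizer_iff''.1 (hN hx) q).1 hq
        have := Subgroup.mem_centralizer_iff.1 hu.2 _ hq'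
        change q * (x * u * x⁻¹) = x * u * x⁻¹ * q
        calc q * (x * u * x⁻¹) = x * ((x⁻¹ * q * x) * u) * x⁻¹ := by group
          _ = x * (u * (x⁻¹ * q * x)) * x⁻¹ := by rw [this]
          _ = _ := by group
    exact this
  intro x hx
  rw [Subgroup.mem_normalizer_iff]
  refine fun u => ⟨key x hx u, fun hu => ?_⟩
  have := key x⁻¹ (inv_mem hx) _ hu
  convert this using 1
  group

/-- Each `α ∈ Aut_F(Q)`, `Q` normal in the base, extends to an element of
`Aut_F(Q C_S(Q))`. -/
theorem exists_autF_sup_baseCentralizer {F : CategoryOn G} {p : ℕ}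
    (hF : F.IsFusionSystem p F.base) {Q : Subgroup G} (hQ : Q ≤ F.base)
    (hN : F.base ≤ Subgroup.normalizer (Q : Set G))
    (hR : Q ⊔ F.baseCentralizer Q ≤ F.base) {α : MulAut Q} (hα : α ∈ F.autF Q hQ) :
    ∃ β ∈ F.autF (Q ⊔ F.baseCentralizer Q) hR,
      ∀ q : Q, (β (Subgroup.inclusion le_sup_left q) : G) = α q := by
  have hfin : Finite F.base := hF.finite
  obtain ⟨ψ, hψ, hψα⟩ := exists_extension hF (X := Q) (Y := F.baseCentralizer Q) hQ hN hα hQ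
    inf_le_left (by
      -- An element `x ∈ Q` acts on `Q` as an inner automorphism, which `α` carries to conjugation
      -- by `y = α(x)`. An element of `C_S(Q)` acts trivially, so `y = 1`.
      rintro x (hx | hx)
      · refine ⟨α ⟨x, hx⟩, hQ (α _).2, fun u v huv => ?_⟩
        have e : v = ⟨x, hx⟩ * u * ⟨x, hx⟩⁻¹ := Subtype.ext huv
        rw [e, map_mul, map_mul, map_inv]
        rfl
      · refine ⟨1, one_mem _, fun u v huv => ?_⟩
        have e : v = u := Subtype.ext (by
          rw [huv, ← Subgroup.mem_centralizer_iff.1 hx.2 u u.2]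
          group)
        rw [e]
        group)
  -- `ψ` maps `Q` onto `Q`, hence elements centralizing `Q` to elements centralizing `Q`. In `key`,
  -- the preimage is pushed forward to `G` so that the two factors can be treated separately.
  have hI : homImage ψ ≤ Q ⊔ F.baseCentralizer Q := by
    have key : Q ⊔ F.baseCentralizer Q ≤ ((Q ⊔ F.baseCentralizer Q).comap
        (F.base.subtype.comp ψ)).map (Q ⊔ F.baseCentralizer Q).subtype := by
      refine sup_le (fun x hx => ⟨⟨x, le_sup_left (a := Q) hx⟩, ?_, rfl⟩)
        (fun x hx => ⟨⟨x, le_sup_right (a := Q) hx⟩, ?_, rfl⟩)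
      · refine Subgroup.mem_sup_left ?_
        have := hψα x hx (le_sup_left (a := Q) hx)
        exact Set.mem_of_eq_of_mem this (α ⟨x, hx⟩).2
      · refine Subgroup.mem_sup_right ⟨(ψ _).2, Subgroup.mem_centralizer_iff.2 fun q hq => ?_⟩
        have e := hψα _ (α.symm ⟨q, hq⟩).2 (le_sup_left (a := Q) (α.symm ⟨q, hq⟩).2)
        simp only [Subtype.coe_eta, MulEquiv.apply_symm_apply] at e
        have hc := Subgroup.mem_centralizer_iff.1 hx.2 _ (α.symm ⟨q, hq⟩).2
        have := congrArg (fun y => (ψ y : G)) (show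
          (⟨_, le_sup_left (a := Q) (α.symm ⟨q, hq⟩).2⟩ : ↥(Q ⊔ F.baseCentralizer Q)) *
            ⟨x, le_sup_right (a := Q) hx⟩ = ⟨x, le_sup_right (a := Q) hx⟩ *
            ⟨_, le_sup_left (a := Q) (α.symm ⟨q, hq⟩).2⟩ from Subtype.ext hc)
        simp only [map_mul, Subgroup.coe_mul] at this
        rw [e] at this
        exact this
    rintro _ ⟨x, rfl⟩
    obtain ⟨y, hy, hyx⟩ := key x.2
    obtain rfl : y = x := Subtype.ext hyx
    exact hy
  have : Finite ↥(Q ⊔ F.baseCentralizer Q) :=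
    Finite.of_injective _ (Subgroup.inclusion_injective hR)
  obtain ⟨β, hβ, hβψ⟩ := exists_autF_of_hom hR
    (F.comp_mem (F.image_mem hψ) (F.inclusion_mem hI hR))
  exact ⟨β, hβ, fun q => (congrArg Subtype.val (hβψ _)).trans (hψα q q.2 _)⟩

/-! ### Correcting an extension by Sylow's theorem -/

/-- Let `Q ≤ R` be normal in the base `S`. If an automorphism `α` of `Q` that conjugates the action
of `X ≤ S` on `Q` into that of `S` extends to an element of `Aut_F(R)`, then it extends to one that
conjugates the action of `X` on `R` into that of `S`. -/
theorem exists_autF_conj {F : CategoryOn G} {p : ℕ} [Fact p.Prime]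
    (hF : F.IsFusionSystem p F.base) {Q R X : Subgroup G}
    (hNQ : F.base ≤ Subgroup.normalizer (Q : Set G)) (hQR : Q ≤ R) (hR : R ≤ F.base)
    (hNR : F.base ≤ Subgroup.normalizer (R : Set G)) {α : MulAut Q} (hX : X ≤ F.base)
    (h : ∀ x ∈ X, ∃ y ∈ F.base,
      ∀ u v : Q, (v : G) = x * u * x⁻¹ → (α v : G) = y * α u * y⁻¹)
    {β : MulAut R} (hβ : β ∈ F.autF R hR)
    (hβα : ∀ q : Q, (β (Subgroup.inclusion hQR q) : G) = α q) :
    ∃ γ ∈ F.autF R hR, (∀ q : Q, (γ (Subgroup.inclusion hQR q) : G) = α q) ∧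
      ∀ x ∈ X, ∃ y ∈ F.base,
        ∀ u v : R, (v : G) = x * u * x⁻¹ → (γ v : G) = y * γ u * y⁻¹ := by
  have hfin : Finite F.base := hF.finite
  have : Finite R := Finite.of_injective _ (Subgroup.inclusion_injective hR)
  have : Finite (MulAut R) := Finite.of_injective _ MulEquiv.toEquiv_injective
  let K : Subgroup (MulAut R) := F.autF R hR ⊓
    { carrier := {κ | ∀ q : Q, κ (Subgroup.inclusion hQR q) = Subgroup.inclusion hQR q}
      one_mem' := fun q => rfl
      mul_mem' := fun {a b} ha hb q => by rw [MulAut.mul_apply, hb q, ha q]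
      inv_mem' := fun {a} ha q => by
        nth_rewrite 1 [← ha q]
        exact MulAut.inv_apply_self _ a _ }
  have hAF := autBase_le_autF hF hR
  -- Elements of `Aut_S(R)` leave `Q` invariant, because `S` normalizes `Q`. So they preserve
  -- triviality on `Q`.
  have hK_conj : ∀ a ∈ F.autBase R, ∀ κ ∈ K, a * κ * a⁻¹ ∈ K := by
    rintro a ha κ ⟨hκ, hκq⟩
    refine ⟨mul_mem (mul_mem (hAF ha) hκ) ((F.autF R hR).inv_mem (hAF ha)), fun q => ?_⟩
    obtain ⟨x, hx, hxa⟩ := inv_mem ha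
    have hq : x * q * x⁻¹ ∈ Q := (Subgroup.mem_normalizer_iff.1 (hNQ hx) q).1 q.2
    have e : a⁻¹ (Subgroup.inclusion hQR q) = Subgroup.inclusion hQR ⟨_, hq⟩ :=
      Subtype.ext (hxa _)
    rw [MulAut.mul_apply, MulAut.mul_apply, e, hκq, ← e, MulAut.apply_inv_self]
  have hAK : F.autBase R ≤ Subgroup.normalizer (K : Set (MulAut R)) := by
    intro a ha
    rw [Subgroup.mem_normalizer_iff]
    refine fun κ => ⟨hK_conj a ha κ, fun hκ => ?_⟩
    have := hK_conj _ (inv_mem ha) _ hκ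
    convert this using 1
    group
  have hA := isPGroup_autBase hF.isPGroup hNR
  -- Intersecting `β Aut_S(R) β⁻¹` with `Aut_S(R) K` gives a `p`-group that contains the conjugated
  -- action of all of `X`, so one `κ` serves every `x ∈ X`.
  have hD : IsPGroup p ↥((F.autBase R).map (MulAut.conj β).toMonoidHom ⊓ (F.autBase R ⊔ K)) :=
    (hA.map _).to_le inf_le_left
  obtain ⟨κ, ⟨hκF, hκQ⟩, hκ⟩ := exists_conj_mem_of_le_sup hA hAK hD inf_le_right
    fun τ hτ hp hn => mem_autBase_of_normalizes hF hR hNR (sup_le hAF inf_le_left hτ) hp hn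
  have hκα : ∀ q : Q, ((κ * β) (Subgroup.inclusion hQR q) : G) = α q := fun q => by
    have e : β (Subgroup.inclusion hQR q) = Subgroup.inclusion hQR (α q) := Subtype.ext (hβα q)
    rw [MulAut.mul_apply, e, hκQ]
    rfl
  refine ⟨κ * β, mul_mem hκF hβ, hκα, fun x hx => ?_⟩
  obtain ⟨y, hy, hxy⟩ := h x hx
  obtain ⟨c, hc⟩ := exists_mulAut_of_mem_normalizer (hNR (hX hx))
  obtain ⟨d, hd⟩ := exists_mulAut_of_mem_normalizer (hNR hy)
  have hcA : c ∈ F.autBase R := ⟨x, hX hx, hc⟩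
  have hdA : d ∈ F.autBase R := ⟨y, hy, hd⟩
  -- By the choice of `y`, the automorphisms `β c_x β⁻¹` and `c_y` agree on `Q`.
  have hmem : d⁻¹ * (β * c * β⁻¹) ∈ K := by
    refine ⟨mul_mem ((F.autF R hR).inv_mem (hAF hdA))
      (mul_mem (mul_mem hβ (hAF hcA)) ((F.autF R hR).inv_mem hβ)),
      fun q => ?_⟩
    obtain ⟨u, rfl⟩ := α.surjective q
    have hu : x * u * x⁻¹ ∈ Q := (Subgroup.mem_normalizer_iff.1 (hNQ (hX hx)) u).1 u.2
    have e : Subgroup.inclusion hQR (α u) = β (Subgroup.inclusion hQR u) :=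
      Subtype.ext (hβα u).symm
    have e₁ : c (Subgroup.inclusion hQR u) = Subgroup.inclusion hQR ⟨_, hu⟩ :=
      Subtype.ext (hc _)
    have e₂ : β (Subgroup.inclusion hQR ⟨_, hu⟩) = d (Subgroup.inclusion hQR (α u)) :=
      Subtype.ext ((hβα _).trans ((hxy u ⟨_, hu⟩ rfl).trans (hd (Subgroup.inclusion hQR (α u))).symm))
    simp only [MulAut.mul_apply]
    nth_rewrite 1 [e]
    rw [MulAut.inv_apply_self, e₁, e₂, MulAut.inv_apply_self]
  have hL : β * c * β⁻¹ ∈ F.autBase R ⊔ K := by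
    have := mul_mem (Subgroup.mem_sup_left (T := K) hdA)
      (Subgroup.mem_sup_right (S := F.autBase R) hmem)
    rwa [mul_inv_cancel_left] at this
  obtain ⟨z, hz, hzκ⟩ := hκ _ ⟨⟨c, hcA, rfl⟩, hL⟩
  refine ⟨z, hz, fun u v huv => ?_⟩
  have e : v = c u := Subtype.ext (huv.trans (hc u).symm)
  have := hzκ ((κ * β) u)
  change ((κ * (β * c * β⁻¹) * κ⁻¹) ((κ * β) u) : G) = _ at this
  simp only [MulAut.mul_apply, MulAut.inv_apply_self] at this ⊢
  rw [e, this]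

/-! ### Factorization of morphisms and the conclusion -/

/-- A morphism of `F` defined on a subgroup containing `Q`, `Q` normal in the base, and mapping `Q`
to itself is a morphism of `N_F(R)`, `R = Q C_S(Q)`, followed by a morphism of `S C_F(Q)`. -/
theorem exists_factorization {F : CategoryOn G} {p : ℕ} [Fact p.Prime]
    (hF : F.IsFusionSystem p F.base) {Q R : Subgroup G} (hQ : Q ≤ F.base)
    (hNQ : F.base ≤ Subgroup.normalizer (Q : Set G)) (hRQ : R = Q ⊔ F.baseCentralizer Q)
    (hR : R ≤ F.base) {P T : Subgroup G} {θ : P →* T}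
    (hθ : θ ∈ F.Hom P T) {α : MulAut Q} (hα : α ∈ F.autF Q hQ)
    (hθα : Restricts θ (MulEquiv.toMonoidHom α)) :
    ∃ (P' : Subgroup G) (χ : P →* P') (η : P' →* T), χ ∈ (F.normalizer R hR).Hom P P' ∧
      η ∈ (F.normalizerCentralizer Q hQ).Hom P' T ∧ η.comp χ = θ := by
  have hNR : F.base ≤ Subgroup.normalizer (R : Set G) :=
    hRQ ▸ F.le_normalizer_sup_baseCentralizer hNQ
  have hbQ : F.baseNormalizer Q = F.base := inf_eq_left.2 hNQ
  have hbR : F.baseNormalizer R = F.base := inf_eq_left.2 hNR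
  obtain ⟨hP, hT⟩ := F.le_base hθ
  obtain ⟨hQP, hθα⟩ := hθα
  have hQR : Q ≤ R := hRQ ▸ le_sup_left
  obtain ⟨β, hβ, hβα⟩ : ∃ β ∈ F.autF R hR,
      ∀ q : Q, (β (Subgroup.inclusion hQR q) : G) = α q := by
    subst hRQ
    exact exists_autF_sup_baseCentralizer hF hQ hNQ hR hα
  -- As `θ` is a homomorphism on `P ≥ Q` extending `α`, it turns the action of `x ∈ P` on `Q` into
  -- that of `y = θ(x)`.
  obtain ⟨γ, hγ, hγα, hγP⟩ := exists_autF_conj hF hNQ hQR hR hNR (X := P) hP (fun x hx => by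
    refine ⟨θ ⟨x, hx⟩, hT (θ _).2, fun u v huv => ?_⟩
    have e : Subgroup.inclusion hQP v =
      ⟨x, hx⟩ * Subgroup.inclusion hQP u * ⟨x, hx⟩⁻¹ := Subtype.ext huv
    have := congrArg Subtype.val (congrArg θ e)
    rw [hθα v, map_mul, map_mul, map_inv] at this
    refine this.trans ?_
    rw [Subgroup.coe_mul, Subgroup.coe_mul, hθα u]
    rfl) hβ hβα
  obtain ⟨ω, hω, hωγ⟩ := exists_extension hF (X := P) (Y := R) hR hNR hγ hP hR (by
    rintro x (hx | hx)
    · exact hγP x hx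
    · refine ⟨γ ⟨x, hx⟩, hR (γ _).2, fun u v huv => ?_⟩
      have e : v = ⟨x, hx⟩ * u * ⟨x, hx⟩⁻¹ := Subtype.ext huv
      rw [e, map_mul, map_mul, map_inv]
      rfl)
  have hPle : P ≤ P ⊔ R := le_sup_left
  have hω₀ := F.comp_mem (F.inclusion_mem hPle (F.le_base hω).1) hω
  have hQω : ∀ q : Q, (ω ⟨q, hPle (hQP q.2)⟩ : G) = α q := fun q =>
    (hωγ q (hQR q.2) _).trans (hγα q)
  have hP' : homImage (ω.comp (Subgroup.inclusion hPle)) ≤ F.base := homImage_le _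
  have hQP' : Q ≤ homImage (ω.comp (Subgroup.inclusion hPle)) := by
    intro q hq
    obtain ⟨u, hu⟩ := α.surjective ⟨q, hq⟩
    exact ⟨⟨u, hQP u.2⟩, (hQω u).trans (congrArg Subtype.val hu)⟩
  -- The second factor is `η = θ ∘ (ω|_P)⁻¹`. Both `θ` and `ω` restrict to `α` on `Q`, so `η` is the
  -- identity on `Q`, that is, conjugation by `1`.
  have hη := F.comp_mem (F.image_symm_mem hω₀) hθ
  refine ⟨homImage (ω.comp (Subgroup.inclusion hPle)),
    (homImageEquiv _ (F.injective hω₀)).toMonoidHom, _, ?_,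
    mem_autNormalizer_of_restricts hQ (hP'.trans hbQ.ge) (hT.trans hbQ.ge) hη
      (one_mem (F.autBase Q)) ⟨hQP', fun q => ?_⟩ ⟨le_rfl, fun _ => rfl⟩, ?_⟩
  · exact mem_autNormalizer_of_restricts hR (hP.trans hbR.ge) (hP'.trans hbR.ge) hω hγ
      ⟨le_sup_right, fun u => hωγ u u.2 _⟩ ⟨hPle, fun _ => rfl⟩
  · obtain ⟨u, rfl⟩ := α.surjective q
    have e : (homImageEquiv _ (F.injective hω₀)).symm (Subgroup.inclusion hQP' (α u)) =
        Subgroup.inclusion hQP u := by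
      rw [MulEquiv.symm_apply_eq]
      exact Subtype.ext (hQω u).symm
    exact (congrArg (fun y => (θ y : G)) e).trans (hθα u)
  · ext x
    exact congrArg (fun y => (θ y : G)) (MulEquiv.symm_apply_apply _ x)

theorem autNormalizer_hom_subset {F : CategoryOn G} {Q : Subgroup G} (hQ : Q ≤ F.base)
    (X : Subgroup (MulAut Q)) {P T : Subgroup G} {φ : P →* T}
    (h : φ ∈ (F.autNormalizer Q hQ X).Hom P T) : φ ∈ F.Hom P T := by
  obtain ⟨-, hT, ψ, hψ, -, h⟩ := h
  exact F.mem_of_restricts h hψ (hT.trans inf_le_left)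

theorem autNormalizer_le (F : CategoryOn G) {Q : Subgroup G} (hQ : Q ≤ F.base)
    (X : Subgroup (MulAut Q)) : F.autNormalizer Q hQ X ≤ F :=
  ⟨inf_le_left, fun _ _ _ h => autNormalizer_hom_subset hQ X h⟩

end CategoryOn

theorem lemma3p7 {p : ℕ} [Fact p.Prime] {G : Type*} [Group G] (S : Subgroup G)
    (F : CategoryOn G) (hF : F.IsFusionSystem p S) :
    let F₁ := F.normalizerCentralizer F.core F.core_le_base
    let F₂ := F.normalizer F.coreCentralizer F.coreCentralizer_le_base
    F₁.base = S ∧ F₂.base = S ∧ F = CategoryOn.generated F₁ F₂ := by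
  intro F₁ F₂
  obtain rfl : F.base = S := hF.base_eq
  have hcore : F.IsNormal F.core := (F.isGreatest_core hF.finite).1
  have h₁ : F₁.base = F.base := inf_eq_left.2 hcore.le_normalizer
  have h₂ : F₂.base = F.base :=
    inf_eq_left.2 (F.le_normalizer_sup_baseCentralizer hcore.le_normalizer)
  have hb : F₁.base ⊔ F₂.base = F.base := by rw [h₁, h₂, sup_idem]
  refine ⟨h₁, h₂, CategoryOn.ext hb.symm ?_⟩
  funext P T
  ext φ
  refine ⟨fun hφ => ⟨(F.le_base hφ).1.trans hb.ge, (F.le_base hφ).2.trans hb.ge, F.injective hφ,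
    fun E hE₁ hE₂ => ?_⟩, fun hφ => hφ.2.2.2 F (F.autNormalizer_le _ _) (F.autNormalizer_le _ _)⟩
  -- The factorization requires a domain containing `Q`, so it is applied to the extension `θ` given
  -- by normality of `Q`. A category containing both factors contains `θ`, hence also its
  -- restriction `φ`.
  obtain ⟨θ, hθ, ⟨α, hα, hθα⟩, hθφ⟩ := hcore.extend hφ
  obtain ⟨P', χ, η, hχ, hη, rfl⟩ := CategoryOn.exists_factorization hF F.core_le_base
    hcore.le_normalizer rfl F.coreCentralizer_le_base hθ hα hθα
  exact E.mem_of_restricts hθφ (E.comp_mem (hE₂.2 _ _ hχ) (hE₁.2 _ _ hη))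
    ((F.le_base hφ).2.trans (h₁.ge.trans hE₁.1))
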